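/- A function $\psi\in L^2(\mathbb{R})$ is called a wavelet if the system $\{\psi_{j,k}=2^{j/2}\psi(2^j\cdot-k): j,k\in\mathbb{Z}\}$ is an orthonormal basis of $L^2(\mathbb{R})$. Let $\hat\psi$ denote the $L^2$ Fourier transform in the normalization $\hat\psi(\xi)=\int_{\mathbb{R}}\psi(x)e^{-ix\xi}\,dx$, and define the dimension function of $\psi$ by $$D_\psi(\xi)=\sum_{j\ge 1}\sum_{k\in\mathbb{Z}}\bigl|\hat\psi\bigl(2^j(\xi+2k\pi)\bigr)\bigr|^2 \in [0,\infty].$$ Let $n\ge 1$ be an integer. If $\psi$ is a wavelet such that $\hat\psi$ is supported in $\left[-\frac{2^{n+2}}{3}\pi,\frac{2^{n+2}}{3}\pi\right]$ (that is, $\hat\psi=0$ almost everywhere outside this interval), then $D_\psi(\xi)\le n$ for almost every $\xi\in\mathbb{R}$. -/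

import Mathlib

open MeasureTheory
open scoped FourierTransform ENNReal

/-- The dyadic dilate and integer translate `ψ_{j,k}(x) = 2^{j/2} ψ(2^j x - k)`. -/
noncomputable def dyadicTranslate (ψ : ℝ → ℂ) (j k : ℤ) (x : ℝ) : ℂ :=
  (((2 : ℝ) ^ ((j : ℝ) / 2) : ℝ) : ℂ) * ψ ((2 : ℝ) ^ j * x - (k : ℝ))

/-- `ψ ∈ L²(ℝ)` is an (orthonormal) wavelet if the system `{ψ_{j,k} : j, k ∈ ℤ}` is an
orthonormal basis of `L²(ℝ)`. -/
def IsWavelet (ψ : Lp ℂ 2 (volume : Measure ℝ)) : Prop :=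
  ∃ b : HilbertBasis (ℤ × ℤ) ℂ (Lp ℂ 2 (volume : Measure ℝ)),
    ∀ j k : ℤ, (b (j, k) : ℝ → ℂ) =ᵐ[volume] dyadicTranslate ψ j k

/-- The Fourier transform of `ψ ∈ L²(ℝ)` in the normalization `ψ̂(ξ) = ∫ ψ(x) e^{-i x ξ} dx`
(extended to `L²` by continuity). Mathlib's `𝓕` uses the kernel `e^{-2π i x ξ}`, hence the
rescaling of the variable. -/
noncomputable def angularFourier (ψ : Lp ℂ 2 (volume : Measure ℝ)) (ξ : ℝ) : ℂ :=
  (𝓕 ψ : Lp ℂ 2 (volume : Measure ℝ)) (ξ / (2 * Real.pi))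

/-- The dimension function `D_ψ(ξ) = ∑_{j ≥ 1} ∑_{k ∈ ℤ} |ψ̂(2^j (ξ + 2kπ))|²`, with values in
`[0, ∞]`; the summation index `j : ℕ` stands for `j + 1 ≥ 1`. -/
noncomputable def dimensionFunction (ψ : Lp ℂ 2 (volume : Measure ℝ)) (ξ : ℝ) : ℝ≥0∞ :=
  ∑' j : ℕ, ∑' k : ℤ,
    ‖angularFourier ψ ((2 : ℝ) ^ (j + 1) * (ξ + 2 * (k : ℝ) * Real.pi))‖ₑ ^ 2

/-! Only Bessel's inequality for the orthonormal system is needed. Write `g = 𝓕 ψ` and `x = ξ / 2π`,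
so that `g` lives on `|x| ≤ 2^(n+1)/3`. Testing Bessel on functions with suitable Fourier transforms
gives, almost everywhere, `∑_{i ≥ 0} |g(2^i x)|² ≤ 1` (`IsWavelet.ae_tsum_dilation_le_one`) and `∑_l
|g(x+l)|² ≤ 1` (`IsWavelet.ae_tsum_translate_le_one`). The rest is pointwise counting
(`tsum_tsum_dyadic_le`). By the translate bound each layer `j` contributes at most 1. If no integer
translate of `x` lies within `1/3` of 0, only the first `n` layers survive. Otherwise, beyond the
first `n - 1` layers only the translate near 0 survives, and the dilation bound makes their total at
most 1. -/

/-! ### Fourier inversion on `L¹ ∩ L²`, Bessel and Parseval in `ℝ≥0∞`. -/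

/-- Both sides pair equally with smooth compactly supported functions: the left by duality of
tempered distributions, the right by Fubini. -/
theorem coeFn_fourierInv_toLp {F : ℝ → ℂ} (h1 : Integrable F) (h2 : MemLp F 2) :
    (𝓕⁻ (h2.toLp F) : Lp ℂ 2 (volume : Measure ℝ)) =ᵐ[volume] 𝓕⁻ F := by
  have hcont : Continuous (𝓕⁻ F) :=
    VectorFourier.fourierIntegral_continuous Real.continuous_fourierChar
      (L := -innerₗ ℝ) (by simp; fun_prop) h1
  apply ae_eq_of_integral_contDiff_smul_eq
  · exact (Lp.memLp _).locallyIntegrable (by norm_num)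
  · exact hcont.locallyIntegrable
  intro g g_smooth g_cpt
  have hg₁ : HasCompactSupport (Complex.ofRealCLM ∘ g) := g_cpt.comp_left rfl
  have hg₂ : ContDiff ℝ (⊤ : ℕ∞) (Complex.ofRealCLM ∘ g) :=
    Complex.ofRealCLM.contDiff.comp g_smooth
  set φ := hg₁.toSchwartzMap hg₂ with hφ
  have key := congrArg (fun T => T φ) (Lp.fourierInv_toTemperedDistribution_eq (h2.toLp F))
  simp only [TemperedDistribution.fourierInv_apply, Lp.toTemperedDistribution_apply] at key
  have hflip := VectorFourier.integral_fourierIntegral_smul_eq_flip (L := -innerₗ ℝ)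
      (μ := volume) (ν := volume) Real.continuous_fourierChar (by simp; fun_prop) (φ.integrable) h1
  have e1 : ∫ x, g x • (𝓕⁻ (h2.toLp F) : Lp ℂ 2 (volume : Measure ℝ)) x
      = ∫ x, φ x • (𝓕⁻ (h2.toLp F) : Lp ℂ 2 (volume : Measure ℝ)) x := by
    simp [hφ]
  have e2 : ∫ x, g x • 𝓕⁻ F x = ∫ x, φ x • 𝓕⁻ F x := by
    simp [hφ]
  have hae : ∫ x, (𝓕⁻ φ) x • (h2.toLp F) x = ∫ x, (𝓕⁻ φ) x • F x :=
    integral_congr_ae (by filter_upwards [h2.coeFn_toLp] with x hx; rw [hx])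
  rw [e1, e2, ← key, hae]
  refine Eq.trans ?_ (hflip.trans ?_)
  · congr 1
    ext x
    rw [SchwartzMap.fourierInv_coe]
    rfl
  · congr 1
    ext x
    congr 1
    change VectorFourier.fourierIntegral 𝐞 volume (-innerₗ ℝ).flip F x =
      VectorFourier.fourierIntegral 𝐞 volume (-innerₗ ℝ) F x
    congr 1
    ext
    simp

theorem enorm_toLp_two_sq {F : ℝ → ℂ} (h2 : MemLp F 2) :
    ‖h2.toLp F‖ₑ ^ 2 = ∫⁻ x, ‖F x‖ₑ ^ 2 := by
  rw [Lp.enorm_toLp]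
  have := eLpNorm_nnreal_pow_eq_lintegral (μ := (volume : Measure ℝ)) (f := F) (p := 2) (by norm_num)
  simpa using this

theorem Orthonormal.tsum_enorm_inner_sq_le {E ι : Type*} [NormedAddCommGroup E]
    [InnerProductSpace ℂ E] {v : ι → E} (hv : Orthonormal ℂ v) (x : E) :
    ∑' i, ‖inner ℂ (v i) x‖ₑ ^ 2 ≤ ‖x‖ₑ ^ 2 := by
  rw [ENNReal.tsum_eq_iSup_sum]
  refine iSup_le fun s => ?_
  have h := ENNReal.ofReal_le_ofReal (hv.sum_inner_products_le x (s := s))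
  rw [ENNReal.ofReal_sum_of_nonneg (fun _ _ => by positivity)] at h
  simpa [ENNReal.ofReal_pow, ofReal_norm] using h

theorem tsum_enorm_integral_fourierChar_sq {h : ℝ → ℂ} (a : ℝ)
    (hL2 : MemLp h 2 (volume.restrict (Set.Ioc a (a + 1)))) :
    ∑' k : ℤ, ‖∫ x in Set.Ioc a (a + 1), 𝐞 (x * k) • h x‖ₑ ^ 2 =
      ∫⁻ x in Set.Ioc a (a + 1), ‖h x‖ₑ ^ 2 := by
  have hab : a < a + 1 := by linarith
  have hs := hasSum_sq_fourierCoeffOn hab hL2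
  have hc : ∀ k : ℤ, fourierCoeffOn hab h (-k) = ∫ x in Set.Ioc a (a + 1), 𝐞 (x * k) • h x := by
    intro k
    rw [fourierCoeffOn_eq_integral, intervalIntegral.integral_of_le hab.le]
    simp only [add_sub_cancel_left, div_one, one_smul, neg_neg]
    congr 1
    ext x
    rw [fourier_coe_apply, Circle.smul_def, Real.fourierChar_apply]
    congr 2
    push_cast
    ring_nf
  have hs' := (Equiv.neg ℤ).hasSum_iff.mpr hs
  simp only [Function.comp_def, Equiv.neg_apply, hc, add_sub_cancel_left, inv_one, one_smul] at hs'
  have := congrArg ENNReal.ofReal hs'.tsum_eq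
  rw [ENNReal.ofReal_tsum_of_nonneg (fun _ => by positivity) hs'.summable,
    intervalIntegral.integral_of_le hab.le,
    ofReal_integral_eq_lintegral_ofReal (hL2.integrable_norm_pow (by norm_num))
      (Filter.Eventually.of_forall fun _ => by positivity)] at this
  simpa [ENNReal.ofReal_pow, ofReal_norm] using this

theorem memLp_fourierChar_smul_comp_mul {p : ℝ≥0∞} {F : ℝ → ℂ} (hF : MemLp F p) {c : ℝ}
    (hc : c ≠ 0) (k : ℝ) : MemLp (fun u => 𝐞 (u * k) • F (c * u)) p := by
  have h1 : MemLp (fun u => F (c * u)) p := by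
    have : MemLp F p (Measure.map (fun x => c * x) volume) := by
      rw [Real.map_volume_mul_left hc]
      exact hF.smul_measure ENNReal.ofReal_ne_top
    exact this.comp_of_map (by fun_prop)
  refine h1.of_le ?_ (Filter.Eventually.of_forall fun u => by rw [Circle.norm_smul])
  have : Continuous fun u : ℝ => 𝐞 (u * k) := Real.continuous_fourierChar.comp (by fun_prop)
  exact this.aestronglyMeasurable.smul h1.1

theorem fourierInv_comp_affine (F : ℝ → ℂ) {c : ℝ} (hc : 0 < c) (k y : ℝ) :
    𝓕⁻ F (c⁻¹ * (y + k)) = c • 𝓕⁻ (fun u => 𝐞 (u * k) • F (c * u)) y := by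
  rw [Real.fourierInv_eq, Real.fourierInv_eq]
  have := Measure.integral_comp_mul_left (fun v => 𝐞 (inner ℝ v (c⁻¹ * (y + k))) • F v) c
  rw [abs_of_pos (by positivity)] at this
  rw [← inv_smul_eq_iff₀ hc.ne', ← this]
  congr 1
  ext u
  rw [smul_smul, ← AddChar.map_add_eq_mul]
  congr 3
  simp
  field_simp

/-! ### Wavelet coefficients on the frequency side. -/

/-- The change of variable `y = 2^j x - k` moves dilation and translation onto the test function,
where they become dilation and modulation of `F`; Plancherel then applies to `ψ` itself. -/
theorem inner_dyadicTranslate {ψ b : Lp ℂ 2 (volume : Measure ℝ)} {j k : ℤ}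
    (hb : (b : ℝ → ℂ) =ᵐ[volume] dyadicTranslate ψ j k)
    {F : ℝ → ℂ} (h1 : Integrable F) (h2 : MemLp F 2) :
    inner ℂ b (𝓕⁻ (h2.toLp F)) = ((2 : ℝ) ^ ((j : ℝ) / 2)) •
      ∫ u, 𝐞 (u * k) • (F ((2 : ℝ) ^ j * u) *
        (starRingEnd ℂ) ((𝓕 ψ : Lp ℂ 2 (volume : Measure ℝ)) u)) := by
  have hc : (0 : ℝ) < 2 ^ j := by positivity
  set c : ℝ := 2 ^ j with hcdef
  set G : ℝ → ℂ := fun u => 𝐞 (u * k) • F (c * u) with hG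
  have G1 : Integrable G :=
    memLp_one_iff_integrable.mp
      (memLp_fourierChar_smul_comp_mul (memLp_one_iff_integrable.mpr h1) hc.ne' k)
  have G2 : MemLp G 2 := memLp_fourierChar_smul_comp_mul h2 hc.ne' k
  set d : ℝ := (2 : ℝ) ^ ((j : ℝ) / 2)
  have s1 : inner ℂ b (𝓕⁻ (h2.toLp F)) =
      ∫ x, d • (fun y => (𝓕⁻ F) (c⁻¹ * (y + k)) * (starRingEnd ℂ) (ψ y)) (c * x - k) := by
    rw [L2.inner_def]
    apply integral_congr_ae
    filter_upwards [hb, coeFn_fourierInv_toLp h1 h2] with x hx hx'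
    rw [hx, hx']
    simp only [dyadicTranslate, RCLike.inner_apply, map_mul, Complex.conj_ofReal,
      sub_add_cancel, Complex.real_smul]
    rw [inv_mul_cancel_left₀ hc.ne']
    ring
  have s2 : inner ℂ ψ (𝓕⁻ (G2.toLp G)) = ∫ y, 𝓕⁻ G y * (starRingEnd ℂ) (ψ y) := by
    rw [L2.inner_def]
    apply integral_congr_ae
    filter_upwards [coeFn_fourierInv_toLp G1 G2] with x hx
    rw [hx, RCLike.inner_apply]
  have s3 : inner ℂ ψ (𝓕⁻ (G2.toLp G)) = ∫ u, 𝐞 (u * k) • (F (c * u) *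
        (starRingEnd ℂ) ((𝓕 ψ : Lp ℂ 2 (volume : Measure ℝ)) u)) := by
    rw [← Lp.inner_fourier_eq, FourierTransform.fourier_fourierInv_eq, L2.inner_def]
    apply integral_congr_ae
    filter_upwards [G2.coeFn_toLp] with x hx
    rw [hx, RCLike.inner_apply, hG]
    simp only [Circle.smul_def, smul_eq_mul, mul_assoc]
  rw [s1, integral_smul, ← s3, s2]
  congr 1
  have s4 := Measure.integral_comp_mul_left
    (fun x => (fun y => (𝓕⁻ F) (c⁻¹ * (y + k)) * (starRingEnd ℂ) (ψ y)) (x - k)) c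
  have s5 := integral_sub_right_eq_self (μ := volume)
    (fun y => (𝓕⁻ F) (c⁻¹ * (y + k)) * (starRingEnd ℂ) (ψ y)) (k : ℝ)
  refine s4.trans ((congrArg _ s5).trans ?_)
  rw [abs_of_pos (by positivity)]
  simp_rw [fourierInv_comp_affine F hc, smul_mul_assoc]
  rw [integral_smul, inv_smul_smul₀ hc.ne']

theorem IsWavelet.tsum_enorm_integral_sq_le {ψ : Lp ℂ 2 (volume : Measure ℝ)} (hψ : IsWavelet ψ)
    {F : ℝ → ℂ} (h1 : Integrable F) (h2 : MemLp F 2) :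
    ∑' j : ℤ, ENNReal.ofReal ((2 : ℝ) ^ j) * ∑' k : ℤ, ‖∫ u, 𝐞 (u * k) • (F ((2 : ℝ) ^ j * u) *
        (starRingEnd ℂ) ((𝓕 ψ : Lp ℂ 2 (volume : Measure ℝ)) u))‖ₑ ^ 2 ≤ ∫⁻ x, ‖F x‖ₑ ^ 2 := by
  obtain ⟨b, hb⟩ := hψ
  have hB := b.orthonormal.tsum_enorm_inner_sq_le (𝓕⁻ (h2.toLp F))
  have hn : ‖(𝓕⁻ (h2.toLp F) : Lp ℂ 2 (volume : Measure ℝ))‖ₑ = ‖h2.toLp F‖ₑ := by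
    rw [← ofReal_norm, ← ofReal_norm, ← Lp.norm_fourier_eq,
      FourierTransform.fourier_fourierInv_eq]
  rw [hn, enorm_toLp_two_sq, ENNReal.tsum_prod'] at hB
  refine le_of_eq_of_le (tsum_congr fun j => ?_) hB
  rw [← ENNReal.tsum_mul_left]
  refine tsum_congr fun k => ?_
  rw [inner_dyadicTranslate (hb j k) h1 h2, enorm_smul, mul_pow]
  congr 1
  rw [Real.enorm_eq_ofReal (by positivity), ← ENNReal.ofReal_pow (by positivity)]
  congr 1
  rw [← Real.rpow_natCast, ← Real.rpow_mul (by norm_num), ← Real.rpow_intCast]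
  congr 1
  push_cast
  ring

/-! ### The dilation bound. -/

theorem ae_le_one_of_forall_setLIntegral_le {S : ℝ → ℝ≥0∞} (hS : Measurable S) {B : Set ℝ}
    (hB : MeasurableSet B)
    (h : ∀ E ⊆ B, MeasurableSet E → ∫⁻ x in E, S x ≤ volume E) : ∀ᵐ x, x ∈ B → S x ≤ 1 := by
  rw [← ae_restrict_iff' hB]
  refine ae_le_of_forall_setLIntegral_le_of_sigmaFinite (g := fun _ => 1) hS fun s hs _ => ?_
  rw [Measure.restrict_restrict hs]
  simpa using h _ Set.inter_subset_right (hs.inter hB)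

theorem ofReal_mul_lintegral_comp_mul_left {f : ℝ → ℝ≥0∞} (hf : Measurable f) {c : ℝ}
    (hc : 0 < c) : ENNReal.ofReal c * ∫⁻ x, f (c * x) = ∫⁻ x, f x := by
  rw [← lintegral_map (g := fun x => c * x) hf (by fun_prop), Real.map_volume_mul_left hc.ne',
    lintegral_smul_measure, smul_eq_mul, ← mul_assoc, abs_of_pos (by positivity),
    ← ENNReal.ofReal_mul hc.le, mul_inv_cancel₀ hc.ne']
  simp

theorem ae_comp_mul_add {P : ℝ → Prop} (hP : ∀ᵐ x, P x) {c : ℝ} (hc : c ≠ 0) (d : ℝ) :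
    ∀ᵐ x, P (c * (x + d)) := by
  have h1 : Measure.QuasiMeasurePreserving (fun x : ℝ => c * x) volume volume := by
    refine ⟨by fun_prop, ?_⟩
    rw [Real.map_volume_mul_left hc]
    exact Measure.smul_absolutelyContinuous
  exact (measurePreserving_add_right volume d).quasiMeasurePreserving.ae (h1.ae hP)

/-- After rescaling, the integrand sits in an interval of length 1, so the integrals are its Fourier
coefficients and Parseval is an equality. -/
theorem ofReal_mul_tsum_enorm_integral_sq {g : ℝ → ℂ} (hgm : Measurable g) (hg : MemLp g 2)
    {E : Set ℝ} (hE : MeasurableSet E) {c : ℝ} (hc : 0 < c) {a : ℝ}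
    (hEa : E ⊆ Set.Ioc (c * a) (c * (a + 1))) :
    ENNReal.ofReal c * ∑' k : ℤ, ‖∫ u, 𝐞 (u * k) • (E.indicator (fun _ => (1 : ℂ)) (c * u) *
        (starRingEnd ℂ) (g u))‖ₑ ^ 2 = ∫⁻ w in E, ‖g (c⁻¹ * w)‖ₑ ^ 2 := by
  set h : ℝ → ℂ := fun u => E.indicator (fun _ => (1 : ℂ)) (c * u) * (starRingEnd ℂ) (g u)
  have hE1 : Measurable (fun u => E.indicator (fun _ => (1 : ℂ)) (c * u)) :=
    (measurable_const.indicator hE).comp (by fun_prop)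
  have hh : MemLp h 2 := by
    refine hg.of_le (hE1.mul (by fun_prop)).aestronglyMeasurable
      (Filter.Eventually.of_forall fun u => ?_)
    by_cases hu : c * u ∈ E <;> simp [h, hu]
  have hzero : ∀ u, u ∉ Set.Ioc a (a + 1) → h u = 0 := by
    intro u hu
    have : c * u ∉ E := by
      intro hmem
      obtain ⟨h1, h2⟩ := hEa hmem
      exact hu ⟨lt_of_mul_lt_mul_left h1 hc.le, le_of_mul_le_mul_left h2 hc⟩
    simp [h, this]
  have e1 : ∀ k : ℤ, ∫ u, 𝐞 (u * k) • (E.indicator (fun _ => (1 : ℂ)) (c * u) *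
      (starRingEnd ℂ) (g u)) = ∫ u in Set.Ioc a (a + 1), 𝐞 (u * k) • h u := by
    intro k
    rw [setIntegral_eq_integral_of_forall_compl_eq_zero (f := fun u => 𝐞 (u * k) • h u)]
    intro u hu
    rw [hzero u hu, smul_zero]
  simp_rw [e1]
  rw [tsum_enorm_integral_fourierChar_sq a (hh.restrict _), ← lintegral_indicator hE,
    ← ofReal_mul_lintegral_comp_mul_left
      (Measurable.indicator (by fun_prop) hE) hc, ← lintegral_indicator measurableSet_Ioc]
  congr 2
  ext u
  by_cases hu : c * u ∈ E
  · have : u ∈ Set.Ioc a (a + 1) := by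
      by_contra hcon
      obtain ⟨h1, h2⟩ := hEa hu
      exact hcon ⟨lt_of_mul_lt_mul_left h1 hc.le, le_of_mul_le_mul_left h2 hc⟩
    simp only [Set.indicator_of_mem this, Set.indicator_of_mem hu, h, one_mul,
      inv_mul_cancel_left₀ hc.ne', RCLike.enorm_conj]
  · by_cases hu' : u ∈ Set.Ioc a (a + 1) <;> simp [h, hu, hu']

/-- Bessel is tested on the indicator of `E`. Since `E` lies in an interval of length `2^J`, every
scale `j ≥ J` is evaluated by Parseval; coarser control is not available, so scales below `J` are
dropped. -/
theorem IsWavelet.setLIntegral_tsum_dilation_le {ψ : Lp ℂ 2 (volume : Measure ℝ)}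
    (hψ : IsWavelet ψ) (J m : ℤ) {E : Set ℝ} (hE : MeasurableSet E)
    (hsub : E ⊆ Set.Ioc (m • (2 : ℝ) ^ J) ((m + 1) • (2 : ℝ) ^ J)) :
    ∫⁻ w in E, ∑' i : ℕ, ‖(𝓕 ψ : Lp ℂ 2 (volume : Measure ℝ)) (((2 : ℝ) ^ (J + i))⁻¹ * w)‖ₑ ^ 2
      ≤ volume E := by
  have hgm : Measurable (𝓕 ψ : Lp ℂ 2 (volume : Measure ℝ)) := (Lp.stronglyMeasurable _).measurable
  have hfin : volume E ≠ ∞ := ((measure_mono hsub).trans_lt (by simp)).ne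
  have h2 : MemLp (E.indicator (fun _ => (1 : ℂ))) 2 :=
    memLp_indicator_const 2 hE 1 (Or.inr hfin)
  have h1 : Integrable (E.indicator (fun _ => (1 : ℂ))) :=
    memLp_one_iff_integrable.mp (memLp_indicator_const 1 hE 1 (Or.inr hfin))
  have hB := hψ.tsum_enorm_integral_sq_le h1 h2
  have hr : ∫⁻ x, ‖E.indicator (fun _ => (1 : ℂ)) x‖ₑ ^ 2 = volume E := by
    rw [← lintegral_indicator_one hE]
    congr 1
    ext x
    by_cases hx : x ∈ E <;> simp [hx]
  rw [hr] at hB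
  rw [lintegral_tsum (fun i => by fun_prop)]
  refine le_trans ?_ ((ENNReal.tsum_comp_le_tsum_of_injective (f := fun i : ℕ => J + (i : ℤ))
    (fun i i' h => by simpa using h) _).trans hB)
  refine le_of_eq (tsum_congr fun i => ?_)
  -- This `a` makes `2^(J+i) * a` the left endpoint `m * 2^J`.
  refine (ofReal_mul_tsum_enorm_integral_sq hgm (Lp.memLp _) hE (by positivity)
    (a := ((2 : ℝ) ^ i)⁻¹ * m) (hsub.trans ?_)).symm
  have hpow : (2 : ℝ) ^ (J + (i : ℤ)) = 2 ^ J * 2 ^ i := by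
    rw [zpow_add₀ (by norm_num), zpow_natCast]
  have h1i : (1 : ℝ) ≤ 2 ^ i := one_le_pow₀ (by norm_num)
  have hJ : (0 : ℝ) < 2 ^ J := by positivity
  apply Set.Ioc_subset_Ioc
  · rw [hpow, zsmul_eq_mul]
    apply le_of_eq
    field_simp
  · rw [hpow, zsmul_eq_mul]
    have : (2 : ℝ) ^ J * 2 ^ i * ((2 ^ i)⁻¹ * m + 1) = m * 2 ^ J + 2 ^ J * 2 ^ i := by
      field_simp
    rw [this]
    push_cast
    nlinarith

theorem IsWavelet.ae_tsum_dilation_le_one {ψ : Lp ℂ 2 (volume : Measure ℝ)} (hψ : IsWavelet ψ) :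
    ∀ᵐ x, ∑' i : ℕ, ‖(𝓕 ψ : Lp ℂ 2 (volume : Measure ℝ)) ((2 : ℝ) ^ i * x)‖ₑ ^ 2 ≤ 1 := by
  have hgm : Measurable (𝓕 ψ : Lp ℂ 2 (volume : Measure ℝ)) := (Lp.stronglyMeasurable _).measurable
  have key : ∀ᵐ x, ∀ N : ℕ, ∀ m : ℤ,
      x ∈ Set.Ioc (m • (2 : ℝ) ^ (-(N : ℤ))) ((m + 1) • (2 : ℝ) ^ (-(N : ℤ))) →
      ∑' i : ℕ, ‖(𝓕 ψ : Lp ℂ 2 (volume : Measure ℝ))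
        (((2 : ℝ) ^ (-(N : ℤ) + i))⁻¹ * x)‖ₑ ^ 2 ≤ 1 := by
    rw [ae_all_iff]
    intro N
    rw [ae_all_iff]
    intro m
    exact ae_le_one_of_forall_setLIntegral_le (by fun_prop) measurableSet_Ioc
      fun E hsub hE => hψ.setLIntegral_tsum_dilation_le _ m hE hsub
  filter_upwards [key] with x hx
  -- With `J = -N` the arguments are `2^(N-i) x`; reversing the order exhibits the first `N`
  -- dilations as part of that sum.
  refine ENNReal.tsum_le_of_sum_range_le fun N => ?_
  have hmem : x ∈ ⋃ m : ℤ, Set.Ioc (m • (2 : ℝ) ^ (-(N : ℤ))) ((m + 1) • (2 : ℝ) ^ (-(N : ℤ))) := by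
    rw [iUnion_Ioc_zsmul (by positivity)]
    trivial
  obtain ⟨m, hm⟩ := Set.mem_iUnion.mp hmem
  refine le_trans ?_ ((ENNReal.sum_le_tsum (Finset.range (N + 1))).trans (hx N m hm))
  rw [← Finset.sum_range_reflect _ (N + 1)]
  refine (Finset.sum_le_sum_of_subset (Finset.range_mono N.le_succ)).trans
    (Finset.sum_le_sum fun i hi => le_of_eq ?_)
  have hi' : i ≤ N := by simpa [Nat.lt_succ_iff] using hi
  congr 4
  rw [← zpow_neg, ← zpow_natCast]
  congr 1
  push_cast [Nat.add_sub_cancel, Nat.cast_sub hi', show N + 1 - 1 - i = N - i by omega]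
  ring

/-! ### The translation bound. -/

theorem setIntegral_preimage_sub {V : Type*} [NormedAddCommGroup V] [NormedSpace ℝ V]
    (f : ℝ → V) (E : Set ℝ) (l : ℝ) :
    ∫ x in (fun x => x - l) ⁻¹' E, f x = ∫ x in E, f (x + l) := by
  have := (measurePreserving_sub_right volume l).setIntegral_preimage_emb
    (MeasurableEquiv.subRight l).measurableEmbedding (fun x => f (x + l)) E
  simpa using this

theorem setLIntegral_preimage_sub (f : ℝ → ℝ≥0∞) (E : Set ℝ) (l : ℝ) :
    ∫⁻ x in (fun x => x - l) ⁻¹' E, f x = ∫⁻ x in E, f (x + l) := by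
  have := (measurePreserving_sub_right volume l).setLIntegral_comp_preimage_emb
    (MeasurableEquiv.subRight l).measurableEmbedding (fun x => f (x + l)) E
  simpa using this

theorem pairwiseDisjoint_preimage_sub_intCast {m : ℝ} {E : Set ℝ}
    (hE : E ⊆ Set.Ioc m (m + 1)) (s : Set ℤ) :
    s.PairwiseDisjoint (fun l : ℤ => (fun x : ℝ => x - l) ⁻¹' E) := by
  intro l _ l' _ hne
  rw [Function.onFun, Set.disjoint_left]
  intro x hx hx'
  obtain ⟨h1, h2⟩ := hE hx
  obtain ⟨h3, h4⟩ := hE hx'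
  apply hne
  have a1 : (l : ℝ) < l' + 1 := by linarith
  have a2 : (l' : ℝ) < l + 1 := by linarith
  norm_cast at a1 a2
  omega

/-- Bessel is tested on `g` cut off to the translates of `E` by `s`. At scale 0 the coefficients are
the Fourier coefficients of the periodization `H`, so Parseval gives `∫ H²` on the left, while the
norm of the test function gives `∫ H`. The bound `M` puts `H` in `L²`. -/
theorem IsWavelet.setLIntegral_sum_translate_sq_le {ψ : Lp ℂ 2 (volume : Measure ℝ)}
    (hψ : IsWavelet ψ) (s : Finset ℤ) {m M : ℝ} {E : Set ℝ} (hE : MeasurableSet E)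
    (hsub : E ⊆ Set.Ioc m (m + 1))
    (hM : ∀ u ∈ E, ∑ l ∈ s, ‖(𝓕 ψ : Lp ℂ 2 (volume : Measure ℝ)) (u + l)‖ ^ 2 ≤ M) :
    ∫⁻ u in E, (∑ l ∈ s, ‖(𝓕 ψ : Lp ℂ 2 (volume : Measure ℝ)) (u + l)‖ₑ ^ 2) ^ 2 ≤
      ∫⁻ u in E, ∑ l ∈ s, ‖(𝓕 ψ : Lp ℂ 2 (volume : Measure ℝ)) (u + l)‖ₑ ^ 2 := by
  set g : ℝ → ℂ := ((𝓕 ψ : Lp ℂ 2 (volume : Measure ℝ)) : ℝ → ℂ)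
  have hgm : Measurable g := (Lp.stronglyMeasurable _).measurable
  have hg : MemLp g 2 := Lp.memLp _
  set T : ℤ → Set ℝ := fun l => (fun x : ℝ => x - l) ⁻¹' E with hT
  have hTm : ∀ l, MeasurableSet (T l) := fun l => hE.preimage (by fun_prop)
  have hdis := pairwiseDisjoint_preimage_sub_intCast hsub (s : Set ℤ)
  set A : Set ℝ := ⋃ l ∈ s, T l with hA
  have hAm : MeasurableSet A := Finset.measurableSet_biUnion _ fun l _ => hTm l
  have hEfin : volume E ≠ ∞ := ((measure_mono hsub).trans_lt (by simp)).ne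
  have hAfin : volume A ≠ ∞ := by
    refine (measure_biUnion_lt_top s.finite_toSet fun l _ => ?_).ne
    rw [(measurePreserving_sub_right volume (l : ℝ)).measure_preimage hE.nullMeasurableSet]
    exact hEfin.lt_top
  have : IsFiniteMeasure (volume.restrict A) := isFiniteMeasure_restrict.mpr hAfin
  have h2 : MemLp (A.indicator g) 2 := hg.indicator hAm
  have h1 : Integrable (A.indicator g) := by
    rw [← memLp_one_iff_integrable, memLp_indicator_iff_restrict hAm]
    exact (hg.restrict A).mono_exponent (by norm_num)
  have hB : ENNReal.ofReal ((2 : ℝ) ^ (0 : ℤ)) * ∑' k : ℤ,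
      ‖∫ u, 𝐞 (u * k) • (A.indicator g ((2 : ℝ) ^ (0 : ℤ) * u) * (starRingEnd ℂ) (g u))‖ₑ ^ 2 ≤
      ∫⁻ x, ‖A.indicator g x‖ₑ ^ 2 :=
    (ENNReal.le_tsum (0 : ℤ)).trans (hψ.tsum_enorm_integral_sq_le h1 h2)
  have hr : ∫⁻ x, ‖A.indicator g x‖ₑ ^ 2 = ∫⁻ u in E, ∑ l ∈ s, ‖g (u + l)‖ₑ ^ 2 := by
    have : ∀ x, ‖A.indicator g x‖ₑ ^ 2 = A.indicator (fun x => ‖g x‖ₑ ^ 2) x := by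
      intro x
      by_cases hx : x ∈ A <;> simp [hx]
    simp_rw [this]
    rw [lintegral_indicator hAm, lintegral_biUnion_finset hdis fun l _ => hTm l,
      lintegral_finsetSum _ fun l _ => by fun_prop]
    exact Finset.sum_congr rfl fun l _ => setLIntegral_preimage_sub _ _ _
  set H : ℝ → ℂ := E.indicator (fun u => ((∑ l ∈ s, ‖g (u + l)‖ ^ 2 : ℝ) : ℂ)) with hH
  have hHm : Measurable H := Measurable.indicator (by fun_prop) hE
  have hHL : MemLp H 2 (volume.restrict (Set.Ioc m (m + 1))) := by
    refine MemLp.of_bound hHm.aestronglyMeasurable (max M 0) (Filter.Eventually.of_forall fun u => ?_)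
    by_cases hu : u ∈ E
    · rw [hH, Set.indicator_of_mem hu, Complex.norm_real,
        Real.norm_of_nonneg (Finset.sum_nonneg fun _ _ => by positivity)]
      exact (hM u hu).trans (le_max_left _ _)
    · simp [hH, hu]
  have hint : Integrable (fun u => ‖g u‖ ^ 2) := hg.integrable_norm_pow (by norm_num)
  have hc : ∀ k : ℤ, ∫ u, 𝐞 (u * k) • (A.indicator g ((2 : ℝ) ^ (0 : ℤ) * u) *
      (starRingEnd ℂ) (g u)) = ∫ u in Set.Ioc m (m + 1), 𝐞 (u * k) • H u := by
    intro k
    have hcts : Continuous fun u : ℝ => 𝐞 (u * k) :=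
      Real.continuous_fourierChar.comp (by fun_prop)
    have hint' : Integrable (fun u => 𝐞 (u * k) • ((‖g u‖ ^ 2 : ℝ) : ℂ)) := by
      have hc : Integrable (fun u => ((‖g u‖ ^ 2 : ℝ) : ℂ)) := hint.ofReal
      refine hc.mono (hcts.aestronglyMeasurable.smul hc.1) (Filter.Eventually.of_forall fun u => ?_)
      rw [Circle.norm_smul]
    have e1 : ∀ u, 𝐞 (u * k) • (A.indicator g ((2 : ℝ) ^ (0 : ℤ) * u) * (starRingEnd ℂ) (g u)) =
        A.indicator (fun u => 𝐞 (u * k) • ((‖g u‖ ^ 2 : ℝ) : ℂ)) u := by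
      intro u
      by_cases hu : u ∈ A
      · simp [hu, Complex.mul_conj']
      · simp [hu]
    have e2 : ∀ u, 𝐞 (u * k) • H u =
        E.indicator (fun u => ∑ l ∈ s, 𝐞 (u * k) • ((‖g (u + l)‖ ^ 2 : ℝ) : ℂ)) u := by
      intro u
      by_cases hu : u ∈ E
      · simp [hH, hu, Finset.smul_sum]
      · simp [hH, hu]
    simp_rw [e1, e2]
    rw [integral_indicator hAm, setIntegral_indicator hE, Set.inter_eq_self_of_subset_right hsub,
      integral_biUnion_finset s (fun l _ => hTm l) hdis fun l _ => hint'.integrableOn]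
    have e3 : ∀ (l : ℤ) (u : ℝ), 𝐞 ((u + l) * k) = 𝐞 (u * k) := by
      intro l u
      rw [add_mul, AddChar.map_add_eq_mul]
      have : 𝐞 ((l : ℝ) * k) = 1 := by
        ext
        rw [Real.fourierChar_apply, Circle.coe_one, Complex.exp_eq_one_iff]
        exact ⟨l * k, by push_cast; ring⟩
      rw [this, mul_one]
    rw [integral_finsetSum]
    · refine Finset.sum_congr rfl fun l _ => ?_
      rw [hT, setIntegral_preimage_sub]
      simp_rw [e3]
    · intro l _
      have := hint'.comp_add_right (l : ℝ)
      simp only [e3] at this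
      exact this.integrableOn
  rw [hr] at hB
  simp_rw [hc] at hB
  rw [tsum_enorm_integral_fourierChar_sq m hHL] at hB
  refine le_trans (le_of_eq ?_) hB
  have : ∀ x, ‖H x‖ₑ ^ 2 = E.indicator (fun u => (∑ l ∈ s, ‖g (u + l)‖ₑ ^ 2) ^ 2) x := by
    intro x
    by_cases hx : x ∈ E
    · rw [hH, Set.indicator_of_mem hx, Set.indicator_of_mem hx]
      congr 1
      rw [← ofReal_norm, Complex.norm_real,
        Real.norm_of_nonneg (Finset.sum_nonneg fun _ _ => by positivity),
        ENNReal.ofReal_sum_of_nonneg fun _ _ => by positivity]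
      simp [ENNReal.ofReal_pow, ofReal_norm]
    · simp [hH, hx]
  simp_rw [this]
  rw [setLIntegral_indicator hE, Set.inter_eq_self_of_subset_left hsub]
  simp

theorem IsWavelet.ae_tsum_translate_le_one {ψ : Lp ℂ 2 (volume : Measure ℝ)} (hψ : IsWavelet ψ) :
    ∀ᵐ x : ℝ, ∑' l : ℤ, ‖(𝓕 ψ : Lp ℂ 2 (volume : Measure ℝ)) (x + l)‖ₑ ^ 2 ≤ 1 := by
  set g : ℝ → ℂ := ((𝓕 ψ : Lp ℂ 2 (volume : Measure ℝ)) : ℝ → ℂ) with hgdef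
  have hgm : Measurable g := (Lp.stronglyMeasurable _).measurable
  -- Finite sums, unit intervals and natural bounds form a countable family, and each exceptional
  -- set has finite integrals.
  have key : ∀ᵐ x : ℝ, ∀ s : Finset ℤ, ∀ m : ℤ, ∀ M : ℕ,
      ¬ (x ∈ Set.Ioc ((0 : ℝ) + m) (0 + m + 1) ∧ 1 < ∑ l ∈ s, ‖g (x + l)‖ₑ ^ 2 ∧
        ∑ l ∈ s, ‖g (x + l)‖ ^ 2 ≤ M) := by
    simp only [ae_all_iff]
    intro s m M
    set E : Set ℝ := {x | x ∈ Set.Ioc ((0 : ℝ) + m) (0 + m + 1) ∧ 1 < ∑ l ∈ s, ‖g (x + l)‖ₑ ^ 2 ∧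
        ∑ l ∈ s, ‖g (x + l)‖ ^ 2 ≤ M} with hEdef
    have hE : MeasurableSet E :=
      MeasurableSet.inter (s₁ := Set.Ioc ((0 : ℝ) + m) (0 + m + 1)) measurableSet_Ioc
        (MeasurableSet.inter (s₁ := {x | 1 < ∑ l ∈ s, ‖g (x + l)‖ₑ ^ 2})
          (s₂ := {x | ∑ l ∈ s, ‖g (x + l)‖ ^ 2 ≤ M})
          (measurableSet_lt (by fun_prop) (by fun_prop))
          (measurableSet_le (by fun_prop) (by fun_prop)))
    have hsub : E ⊆ Set.Ioc ((0 : ℝ) + m) (0 + m + 1) := fun x hx => hx.1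
    have hle := hψ.setLIntegral_sum_translate_sq_le s hE hsub fun u hu => hu.2.2
    have hbound : ∀ x ∈ E, ∑ l ∈ s, ‖g (x + l)‖ₑ ^ 2 ≤ (M : ℝ≥0∞) := by
      intro x hx
      have := ENNReal.ofReal_le_ofReal hx.2.2
      rw [ENNReal.ofReal_sum_of_nonneg fun _ _ => by positivity] at this
      simpa [ENNReal.ofReal_pow, ofReal_norm] using this
    have hEfin : volume E ≠ ∞ := ((measure_mono hsub).trans_lt (by simp)).ne
    have hzero : volume E = 0 := by
      by_contra hne
      -- Where the sum exceeds 1 it is strictly below its square, contradicting `hle` on a set of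
      -- positive measure.
      refine hle.not_gt (setLIntegral_strict_mono hE hne (by fun_prop) ?_ ?_)
      · refine ((setLIntegral_mono measurable_const hbound).trans_lt ?_).ne
        rw [setLIntegral_const]
        exact ENNReal.mul_lt_top (by simp) hEfin.lt_top
      · refine Filter.Eventually.of_forall fun x hx => ?_
        have h1 := hx.2.1
        have h2 := ((hbound x hx).trans_lt (ENNReal.natCast_lt_top M)).ne
        generalize ∑ l ∈ s, ‖g (x + l)‖ₑ ^ 2 = y at h1 h2 ⊢
        lift y to NNReal using h2
        norm_cast at h1 ⊢
        exact lt_self_pow₀ h1 (by norm_num)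
    exact measure_eq_zero_iff_ae_notMem.mp hzero
  filter_upwards [key] with x hx
  rw [ENNReal.tsum_eq_iSup_sum]
  refine iSup_le fun s => ?_
  by_contra hcon
  have hmem : x ∈ ⋃ m : ℤ, Set.Ioc ((0 : ℝ) + m) (0 + m + 1) := by
    rw [iUnion_Ioc_add_intCast]
    trivial
  obtain ⟨m, hm⟩ := Set.mem_iUnion.mp hmem
  obtain ⟨M, hM⟩ := exists_nat_ge (∑ l ∈ s, ‖g (x + l)‖ ^ 2)
  exact hx s m M ⟨hm, not_le.mp hcon, hM⟩

/-! ### Counting layers, and the conclusion. -/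

theorem tsum_tsum_dyadic_le {a : ℝ → ℝ≥0∞} {n : ℕ} (hn : 1 ≤ n) {x : ℝ}
    (hsupp : ∀ (j : ℕ) (k : ℤ), (2 : ℝ) ^ (n + 1) / 3 < |(2 : ℝ) ^ (j + 1) * (x + k)| →
      a ((2 : ℝ) ^ (j + 1) * (x + k)) = 0)
    (htrans : ∀ j : ℕ, ∑' k : ℤ, a ((2 : ℝ) ^ (j + 1) * x + k) ≤ 1)
    (hdil : ∀ m : ℤ, ∑' i : ℕ, a ((2 : ℝ) ^ i * (x + m)) ≤ 1)
    (hne : ∀ m : ℤ, |x + m| ≠ 1 / 3) :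
    ∑' j : ℕ, ∑' k : ℤ, a ((2 : ℝ) ^ (j + 1) * (x + k)) ≤ n := by
  obtain ⟨N, rfl⟩ : ∃ N, n = N + 1 := ⟨n - 1, by omega⟩
  have hone : ∀ j : ℕ, ∑' k : ℤ, a ((2 : ℝ) ^ (j + 1) * (x + k)) ≤ 1 := by
    intro j
    refine le_trans (le_of_eq ?_) ((ENNReal.tsum_comp_le_tsum_of_injective
      -- Layer `j` runs over the sublattice `2^(j+1) ℤ` of the translates of `2^(j+1) x`.
      (f := fun k : ℤ => 2 ^ (j + 1) * k) (fun k k' h => by simpa using h)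
      (fun k : ℤ => a ((2 : ℝ) ^ (j + 1) * x + k))).trans (htrans j))
    refine tsum_congr fun k => ?_
    push_cast
    rw [mul_add]
  have hsplit : ∀ L : ℕ, (∑ j ∈ Finset.range L, ∑' k : ℤ, a ((2 : ℝ) ^ (j + 1) * (x + k))) ≤ L := by
    intro L
    simpa using Finset.sum_le_sum (s := Finset.range L) fun j _ => hone j
  by_cases hm : ∃ m : ℤ, |x + m| < 1 / 3
  · obtain ⟨m, hm⟩ := hm
    have hsingle : ∀ i : ℕ, ∑' k : ℤ, a ((2 : ℝ) ^ (i + N + 1) * (x + k)) =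
        a ((2 : ℝ) ^ (i + N + 1) * (x + m)) := by
      intro i
      refine tsum_eq_single m fun k hk => hsupp _ _ ?_
      rw [abs_mul, abs_of_pos (by positivity : (0 : ℝ) < 2 ^ (i + N + 1))]
      have hkm : (1 : ℝ) ≤ |(k : ℝ) - m| := by
        exact_mod_cast Int.one_le_abs (sub_ne_zero.mpr hk)
      have habs : |(k : ℝ) - m| ≤ |x + k| + |x + m| := by
        have := abs_sub (x + k) (x + m)
        simpa using this
      -- All other translates are farther than `2/3` from 0, so they leave the support one layer
      -- earlier than the `1/3` bound would give.
      have h23 : 2 / 3 < |x + k| := by linarith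
      have hp : (2 : ℝ) ^ (N + 1) ≤ 2 ^ (i + N + 1) :=
        pow_le_pow_right₀ (by norm_num) (by omega)
      have hp0 : (0 : ℝ) < 2 ^ (N + 1) := by positivity
      calc (2 : ℝ) ^ (N + 1 + 1) / 3 = 2 ^ (N + 1) * (2 / 3) := by ring
        _ < 2 ^ (N + 1) * |x + k| := by gcongr
        _ ≤ 2 ^ (i + N + 1) * |x + k| := by gcongr
    rw [← ENNReal.summable.sum_add_tsum_nat_add' (k := N), Nat.cast_add, Nat.cast_one]
    refine add_le_add (hsplit N) ?_
    simp_rw [hsingle]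
    exact (ENNReal.tsum_comp_le_tsum_of_injective (f := fun i : ℕ => i + N + 1)
      (fun i i' h => by simpa using h) (fun i : ℕ => a ((2 : ℝ) ^ i * (x + m)))).trans (hdil m)
  · push Not at hm
    rw [← ENNReal.summable.sum_add_tsum_nat_add' (k := N + 1)]
    have hz : ∑' i : ℕ, ∑' k : ℤ, a ((2 : ℝ) ^ (i + (N + 1) + 1) * (x + k)) = 0 := by
      refine ENNReal.tsum_eq_zero.mpr fun i => ENNReal.tsum_eq_zero.mpr fun k => hsupp _ _ ?_
      rw [abs_mul, abs_of_pos (by positivity : (0 : ℝ) < 2 ^ (i + (N + 1) + 1))]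
      have h13 : 1 / 3 < |x + k| := lt_of_le_of_ne (hm k) (hne k).symm
      have hp : (2 : ℝ) ^ (N + 1 + 1) ≤ 2 ^ (i + (N + 1) + 1) :=
        pow_le_pow_right₀ (by norm_num) (by omega)
      have hp0 : (0 : ℝ) < 2 ^ (N + 1 + 1) := by positivity
      calc (2 : ℝ) ^ (N + 1 + 1) / 3 = 2 ^ (N + 1 + 1) * (1 / 3) := by ring
        _ < 2 ^ (N + 1 + 1) * |x + k| := by gcongr
        _ ≤ 2 ^ (i + (N + 1) + 1) * |x + k| := by gcongr
    rw [hz, add_zero]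
    exact hsplit (N + 1)

theorem theorem1 (n : ℕ) (hn : 1 ≤ n) (ψ : Lp ℂ 2 (volume : Measure ℝ)) (hψ : IsWavelet ψ)
    (hsupp : ∀ᵐ ξ : ℝ, ξ ∉ Set.Icc (-((2 : ℝ) ^ (n + 2) / 3 * Real.pi))
        ((2 : ℝ) ^ (n + 2) / 3 * Real.pi) → angularFourier ψ ξ = 0) :
    ∀ᵐ ξ : ℝ, dimensionFunction ψ ξ ≤ (n : ℝ≥0∞) := by
  have hpi := Real.pi_pos
  set g : ℝ → ℂ := ((𝓕 ψ : Lp ℂ 2 (volume : Measure ℝ)) : ℝ → ℂ) with hg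
  have hsupp' : ∀ᵐ x : ℝ, (2 : ℝ) ^ (n + 1) / 3 < |x| → g x = 0 := by
    have := ae_comp_mul_add hsupp (c := 2 * Real.pi) (by positivity) 0
    filter_upwards [this] with x hx hlt
    have h := hx ?_
    · simpa [angularFourier, hpi.ne'] using h
    · rw [Set.mem_Icc, ← abs_le, add_zero, abs_mul, abs_of_pos (by positivity), not_le]
      calc (2 : ℝ) ^ (n + 2) / 3 * Real.pi = 2 * Real.pi * (2 ^ (n + 1) / 3) := by ring
        _ < 2 * Real.pi * |x| := by gcongr
  have main : ∀ᵐ x : ℝ,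
      ∑' j : ℕ, ∑' k : ℤ, ‖g ((2 : ℝ) ^ (j + 1) * (x + k))‖ₑ ^ 2 ≤ (n : ℝ≥0∞) := by
    have h1 : ∀ᵐ x : ℝ, ∀ (j : ℕ) (k : ℤ), (2 : ℝ) ^ (n + 1) / 3 < |(2 : ℝ) ^ (j + 1) * (x + k)| →
        g ((2 : ℝ) ^ (j + 1) * (x + k)) = 0 := by
      simp only [ae_all_iff (ι := ℕ), ae_all_iff (ι := ℤ)]
      exact fun j k => ae_comp_mul_add hsupp' (by positivity) _
    have h2 : ∀ᵐ x : ℝ, ∀ j : ℕ, ∑' k : ℤ, ‖g ((2 : ℝ) ^ (j + 1) * x + k)‖ₑ ^ 2 ≤ 1 := by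
      rw [ae_all_iff]
      intro j
      simpa using ae_comp_mul_add hψ.ae_tsum_translate_le_one
        (c := (2 : ℝ) ^ (j + 1)) (by positivity) 0
    have h3 : ∀ᵐ x : ℝ, ∀ m : ℤ, ∑' i : ℕ, ‖g ((2 : ℝ) ^ i * (x + m))‖ₑ ^ 2 ≤ 1 := by
      rw [ae_all_iff]
      intro m
      simpa using ae_comp_mul_add hψ.ae_tsum_dilation_le_one (c := 1) one_ne_zero (m : ℝ)
    -- At distance exactly `1/3`, layer `n` would hit the endpoint of the closed support interval.
    have h4 : ∀ᵐ x : ℝ, ∀ m : ℤ, |x + m| ≠ 1 / 3 := by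
      rw [ae_all_iff]
      intro m
      filter_upwards [Measure.ae_ne volume (1 / 3 - (m : ℝ)), Measure.ae_ne volume (-(1 / 3) - (m : ℝ))]
        with x hx hx' habs
      rcases (abs_eq (by norm_num)).mp habs with h | h
      · exact hx (by linarith)
      · exact hx' (by linarith)
    filter_upwards [h1, h2, h3, h4] with x hx1 hx2 hx3 hx4
    refine tsum_tsum_dyadic_le (a := fun x => ‖g x‖ₑ ^ 2) hn (fun j k h => ?_) hx2 hx3 hx4
    simp [hx1 j k h]
  filter_upwards [ae_comp_mul_add main (c := (2 * Real.pi)⁻¹) (by positivity) 0] with ξ hξ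
  refine le_of_eq_of_le ?_ hξ
  refine tsum_congr fun j => tsum_congr fun k => ?_
  rw [angularFourier]
  congr 3
  field_simp
  simp
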